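/- Let $p$ be a prime, $S$ a finite $p$-group and $\mathcal F$ a saturated fusion system over $S$ (in the sense of Broto, Levi and Oliver). For a set $\mathcal X$ of subgroups of $S$, consider the chains $Q_0<Q_1<\dots<Q_n$ ($n\ge 0$) of subgroups $Q_i\in\mathcal X$ with $Q_i\lhd Q_n$ for all $i$. Two such chains $Q_0<\dots<Q_n$ and $Q'_0<\dots<Q'_m$ are $\mathcal F$-isomorphic if $m=n$ and there is an isomorphism $\varphi\colon Q_n\to Q'_n$ in $\mathcal F$ with $\varphi(Q_i)=Q'_i$ for all $i$. Let $[\mathcal S_\lhd(\mathcal F)]_{\mathcal X}$ be the poset of $\mathcal F$-isomorphism classes of these chains, where $[Q_0<\dots<Q_m]\le[R_0<\dots<R_n]$ if there is a morphism $\varphi\in\operatorname{Hom}_{\mathcal F}(Q_m,R_n)$ mapping each $Q_i$ onto some $R_j$. For a poset $\mathcal P$, regarded as a category, let $H^n(\mathcal P;\mathbb Z)$ be the integral cohomology of its nerve, i.e. the cohomology of the cochain complex $C^n=\prod_{\sigma\in (N\mathcal P)_n}\mathbb Z$, $d=\sum_i(-1)^id^i$ (equivalently, $\varprojlim^n$ over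 $\mathcal P$ of the constant functor $\mathbb Z$). (a) If $\mathcal X$ is the set of all subgroups of $S$, then $H^n([\mathcal S_\lhd(\mathcal F)]_{\mathcal X}^{op};\mathbb Z)=0$ for all $n\ge 1$ and $H^0([\mathcal S_\lhd(\mathcal F)]_{\mathcal X}^{op};\mathbb Z)\cong\mathbb Z$. (b) If $S\ne 1$ and $\mathcal X$ is the set of all non-trivial subgroups of $S$, then likewise $H^n([\mathcal S_\lhd(\mathcal F)]_{\mathcal X}^{op};\mathbb Z)=0$ for all $n\ge 1$ and $H^0([\mathcal S_\lhd(\mathcal F)]_{\mathcal X}^{op};\mathbb Z)\cong\mathbb Z$. -/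

import Mathlib

open CategoryTheory

universe u

/-! ## Cohomology of a small category with integer coefficients -/

/-- The contravariant functor sending a set `T` to the abelian group `∏_{t ∈ T} ℤ`. -/
def integerFunctions : (Type u)ᵒᵖ ⥤ ModuleCat.{u} ℤ where
  obj T := ModuleCat.of ℤ (T.unop → ℤ)
  map f := ModuleCat.ofHom (LinearMap.funLeft ℤ ℤ f.unop)

/-- The cosimplicial abelian group `n ↦ ∏_{σ ∈ (N C)_n} ℤ`, where `N C` is the nerve of `C`: the
cosimplicial replacement of the constant functor `C ⥤ Ab` with value `ℤ`. -/
def integerCosimplicial (C : Type u) [Category.{u} C] : CosimplicialObject (ModuleCat.{u} ℤ) :=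
  (nerve C).rightOp ⋙ integerFunctions

/-- The cochain complex with `C^n = ∏_{σ ∈ (N C)_n} ℤ` and `d = ∑ i, (-1)^i d^i`. -/
noncomputable def integerCochains (C : Type u) [Category.{u} C] :
    CochainComplex (ModuleCat.{u} ℤ) ℕ :=
  (AlgebraicTopology.alternatingCofaceMapComplex (ModuleCat.{u} ℤ)).obj (integerCosimplicial C)

/-- `H^n(C; ℤ)`, the cohomology of the (nerve of the) category `C`, i.e. the `n`-th higher limit
over `C` of the constant functor with value `ℤ`. -/
noncomputable def integerCohomology (C : Type u) [Category.{u} C] (n : ℕ) : ModuleCat.{u} ℤ :=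
  (integerCochains C).homology n

/-! ## Fusion systems -/

/-- A fusion system over a group `S`: a category whose objects are the subgroups of `S`, whose
morphisms are injective homomorphisms, containing all the maps induced by conjugation in `S`, and
in which every morphism is an isomorphism of the category followed by an inclusion. -/
structure FusionSystem (S : Type u) [Group S] where
  /-- The morphism sets. -/
  hom : ∀ P Q : Subgroup S, Set (P →* Q)
  injective : ∀ {P Q : Subgroup S} {φ : P →* Q}, φ ∈ hom P Q → Function.Injective φ
  conj_mem : ∀ {P Q : Subgroup S} (g : S) (φ : P →* Q),
    (∀ x : P, (φ x : S) = g * (x : S) * g⁻¹) → φ ∈ hom P Q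
  comp_mem : ∀ {P Q R : Subgroup S} {φ : P →* Q} {ψ : Q →* R},
    φ ∈ hom P Q → ψ ∈ hom Q R → ψ.comp φ ∈ hom P R
  exists_factor : ∀ {P Q : Subgroup S} {φ : P →* Q}, φ ∈ hom P Q →
    ∃ (R : Subgroup S) (hR : R ≤ Q) (e : P ≃* R),
      e.toMonoidHom ∈ hom P R ∧ e.symm.toMonoidHom ∈ hom R P ∧
        φ = (Subgroup.inclusion hR).comp e.toMonoidHom

namespace FusionSystem

variable {S : Type u} [Group S]

/-- The image in `S` of a subgroup `R ≤ P` under a homomorphism `φ : P →* Q`. -/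
def image {P Q : Subgroup S} (φ : P →* Q) (R : Subgroup S) : Subgroup S :=
  (R.subgroupOf P).map (Q.subtype.comp φ)

theorem mem_image {P Q : Subgroup S} {φ : P →* Q} {R : Subgroup S} {y : S} :
    y ∈ image φ R ↔ ∃ x : P, (x : S) ∈ R ∧ (φ x : S) = y := by
  rfl

theorem image_id {P R : Subgroup S} (h : R ≤ P) : image (MonoidHom.id P) R = R := by
  ext y
  rw [mem_image]
  exact ⟨fun ⟨x, hx, hy⟩ => hy ▸ hx, fun hy => ⟨⟨y, h hy⟩, hy, rfl⟩⟩

theorem image_comp {P Q T : Subgroup S} (φ : P →* Q) (ψ : Q →* T) (R : Subgroup S) :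
    image (ψ.comp φ) R = image ψ (image φ R) := by
  ext y
  simp only [mem_image]
  constructor
  · rintro ⟨x, hx, rfl⟩
    exact ⟨φ x, ⟨x, hx, rfl⟩, rfl⟩
  · rintro ⟨z, ⟨x, hx, hz⟩, rfl⟩
    obtain rfl : φ x = z := Subtype.ext hz
    exact ⟨x, hx, rfl⟩

theorem image_strictMono {P Q : Subgroup S} {φ : P →* Q} (hφ : Function.Injective φ)
    {R T : Subgroup S} (hT : T ≤ P) (h : R < T) : image φ R < image φ T := by
  refine lt_of_le_of_ne ?_ ?_
  · intro y hy
    obtain ⟨x, hx, rfl⟩ := mem_image.1 hy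
    exact mem_image.2 ⟨x, h.le hx, rfl⟩
  · intro heq
    refine h.not_ge fun x hx => ?_
    have h1 : (φ ⟨x, hT hx⟩ : S) ∈ image φ R := heq ▸ mem_image.2 ⟨⟨x, hT hx⟩, hx, rfl⟩
    obtain ⟨z, hz, hzx⟩ := mem_image.1 h1
    obtain rfl : z = ⟨x, hT hx⟩ := hφ (Subtype.ext hzx)
    exact hz

theorem image_symm {P Q : Subgroup S} (e : P ≃* Q) {R : Subgroup S} (h : R ≤ P) :
    image e.symm.toMonoidHom (image e.toMonoidHom R) = R := by
  rw [← image_comp]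
  have : e.symm.toMonoidHom.comp e.toMonoidHom = MonoidHom.id P := by ext; simp
  rw [this, image_id h]

/-- Isomorphisms of the category `F`. -/
def IsIso (F : FusionSystem S) {P Q : Subgroup S} (e : P ≃* Q) : Prop :=
  e.toMonoidHom ∈ F.hom P Q ∧ e.symm.toMonoidHom ∈ F.hom Q P

/-- `P` and `Q` are isomorphic in `F`. -/
def Conjugate (F : FusionSystem S) (P Q : Subgroup S) : Prop :=
  ∃ e : P ≃* Q, F.IsIso e

theorem id_mem (F : FusionSystem S) (P : Subgroup S) : MonoidHom.id P ∈ F.hom P P :=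
  F.conj_mem 1 _ (by simp)

theorem IsIso.refl (F : FusionSystem S) (P : Subgroup S) : F.IsIso (MulEquiv.refl P) :=
  ⟨F.id_mem P, F.id_mem P⟩

theorem IsIso.symm {F : FusionSystem S} {P Q : Subgroup S} {e : P ≃* Q} (h : F.IsIso e) :
    F.IsIso e.symm :=
  ⟨h.2, h.1⟩

theorem IsIso.trans {F : FusionSystem S} {P Q R : Subgroup S} {e : P ≃* Q} {f : Q ≃* R}
    (he : F.IsIso e) (hf : F.IsIso f) : F.IsIso (e.trans f) :=
  ⟨F.comp_mem he.1 hf.1, F.comp_mem hf.2 he.2⟩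

/-- `P` is fully normalized in `F`. -/
def FullyNormalized (F : FusionSystem S) (P : Subgroup S) : Prop :=
  ∀ Q : Subgroup S, F.Conjugate P Q →
    Nat.card (Subgroup.normalizer (Q : Set S)) ≤ Nat.card (Subgroup.normalizer (P : Set S))

/-- `P` is fully centralized in `F`. -/
def FullyCentralized (F : FusionSystem S) (P : Subgroup S) : Prop :=
  ∀ Q : Subgroup S, F.Conjugate P Q →
    Nat.card (Subgroup.centralizer (Q : Set S)) ≤ Nat.card (Subgroup.centralizer (P : Set S))

/-- The automorphism group of `P` in `F`. -/
def aut (F : FusionSystem S) (P : Subgroup S) : Subgroup (MulAut P) where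
  carrier := {e | F.IsIso e}
  one_mem' := IsIso.refl F P
  mul_mem' := fun ha hb => IsIso.trans hb ha
  inv_mem' := fun ha => IsIso.symm ha

/-- `Aut_S(P)`: the automorphisms of `P` induced by conjugation by elements of `N_S(P)`. -/
def autConj (P : Subgroup S) : Subgroup (MulAut P) :=
  P.normalizerMonoidHom.range

/-- For an isomorphism `e : P ≃* Q`, the group `N_e` of all `g ∈ N_S(P)` such that
`e ∘ c_g ∘ e⁻¹ ∈ Aut_S(Q)`. -/
def extensionDomain {P Q : Subgroup S} (e : P ≃* Q) : Subgroup S :=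
  ((autConj Q).comap ((MulAut.congr e).toMonoidHom.comp P.normalizerMonoidHom)).map
    (Subgroup.normalizer (P : Set S)).subtype

theorem le_extensionDomain {P Q : Subgroup S} (e : P ≃* Q) : P ≤ extensionDomain e := by
  intro x hx
  refine ⟨⟨x, Subgroup.le_normalizer hx⟩, ?_, rfl⟩
  refine ⟨⟨e ⟨x, hx⟩, Subgroup.le_normalizer (e ⟨x, hx⟩).2⟩, ?_⟩
  ext y
  have h : e (⟨x, hx⟩ * e.symm y * ⟨x, hx⟩⁻¹) = e ⟨x, hx⟩ * y * (e ⟨x, hx⟩)⁻¹ := by simp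
  exact (congrArg Subtype.val h).symm

/-- A fusion system over the finite `p`-group `S` is saturated if
(I) every fully normalized subgroup `P` is fully centralized, and `Aut_S(P)` is a Sylow
`p`-subgroup of `Aut_F(P)`;
(II) every isomorphism `e : P ≃* Q` of `F` onto a fully centralized subgroup `Q` extends to a
morphism of `F` defined on `N_e`. -/
structure IsSaturated (F : FusionSystem S) (p : ℕ) : Prop where
  fullyCentralized : ∀ P : Subgroup S, F.FullyNormalized P → F.FullyCentralized P
  sylow : ∀ P : Subgroup S, F.FullyNormalized P →
    ∃ T : Sylow p (F.aut P), (T : Subgroup (F.aut P)) = (autConj P).subgroupOf (F.aut P)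
  extend : ∀ (P Q : Subgroup S) (e : P ≃* Q), F.IsIso e → F.FullyCentralized Q →
    ∃ ψ ∈ F.hom (extensionDomain e) ⊤, ∀ x : P,
      (ψ (Subgroup.inclusion (le_extensionDomain e) x) : S) = e x

/-! ## Normal chains -/

/-- Chains `Q₀ < Q₁ < ... < Qₙ` (`n ≥ 0`) of subgroups of `S` that belong to the collection `X`
and are normal in `Qₙ`. -/
@[ext]
structure NormalChain (F : FusionSystem S) (X : Set (Subgroup S)) where
  /-- The number `n` of strict inclusions. -/
  length : ℕ
  /-- The subgroups `Qᵢ`. -/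
  term : Fin (length + 1) → Subgroup S
  strictMono : StrictMono term
  mem : ∀ i, term i ∈ X
  normal : ∀ i, ((term i).subgroupOf (term (Fin.last length))).Normal

namespace NormalChain

variable {F : FusionSystem S} {X : Set (Subgroup S)}

/-- The largest term `Qₙ` of a chain. -/
def top (c : F.NormalChain X) : Subgroup S := c.term (Fin.last c.length)

theorem term_le_top (c : F.NormalChain X) (i : Fin (c.length + 1)) : c.term i ≤ c.top :=
  c.strictMono.monotone (Fin.le_last i)

/-- `F`-isomorphism of chains: `Q₀ < ... < Qₙ` and `Q'₀ < ... < Q'ₙ` are isomorphic if there is an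
isomorphism `e : Qₙ ≃* Q'ₙ` of `F` with `e(Qᵢ) = Q'ᵢ` for all `i`. -/
def Isomorphic (c d : F.NormalChain X) : Prop :=
  ∃ (h : c.length = d.length) (e : c.top ≃* d.top), F.IsIso e ∧
    ∀ i : Fin (c.length + 1),
      image e.toMonoidHom (c.term i) = d.term (Fin.cast (congrArg (· + 1) h) i)

/-- Existence of a morphism of the subdivision category from `Q₀ < ... < Qₘ` to
`R₀ < ... < Rₙ`: a morphism `φ : Qₘ → Rₙ` of `F` mapping every `Qᵢ` onto some `Rⱼ`. -/
def Maps (c d : F.NormalChain X) : Prop :=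
  ∃ φ ∈ F.hom c.top d.top, ∀ i, ∃ j, image φ (c.term i) = d.term j

theorem Isomorphic.refl (c : F.NormalChain X) : c.Isomorphic c :=
  ⟨rfl, MulEquiv.refl _, IsIso.refl F _, fun i => image_id (c.term_le_top i)⟩

theorem Isomorphic.symm {c d : F.NormalChain X} (h : c.Isomorphic d) : d.Isomorphic c := by
  obtain ⟨hl, e, he, hi⟩ := h
  refine ⟨hl.symm, e.symm, he.symm, fun j => ?_⟩
  have h1 := hi (Fin.cast (congrArg (· + 1) hl.symm) j)
  rw [show Fin.cast (congrArg (· + 1) hl) (Fin.cast (congrArg (· + 1) hl.symm) j) = j from rfl]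
    at h1
  rw [← h1]
  exact image_symm e (c.term_le_top _)

theorem Isomorphic.trans {a b c : F.NormalChain X} (h : a.Isomorphic b) (h' : b.Isomorphic c) :
    a.Isomorphic c := by
  obtain ⟨hl, e, he, hi⟩ := h
  obtain ⟨hl', e', he', hi'⟩ := h'
  refine ⟨hl.trans hl', e.trans e', he.trans he', fun i => ?_⟩
  have : (e.trans e').toMonoidHom = e'.toMonoidHom.comp e.toMonoidHom := rfl
  rw [this, image_comp, hi i, hi' _]
  rfl

theorem Isomorphic.maps {c d : F.NormalChain X} (h : c.Isomorphic d) : c.Maps d := by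
  obtain ⟨_, e, he, hi⟩ := h
  exact ⟨e.toMonoidHom, he.1, fun i => ⟨_, hi i⟩⟩

theorem Maps.refl (c : F.NormalChain X) : c.Maps c :=
  (Isomorphic.refl c).maps

theorem Maps.trans {a b c : F.NormalChain X} (h : a.Maps b) (h' : b.Maps c) : a.Maps c := by
  obtain ⟨φ, hφ, h1⟩ := h
  obtain ⟨ψ, hψ, h2⟩ := h'
  refine ⟨ψ.comp φ, F.comp_mem hφ hψ, fun i => ?_⟩
  obtain ⟨j, hj⟩ := h1 i
  obtain ⟨k, hk⟩ := h2 j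
  exact ⟨k, by rw [image_comp, hj, hk]⟩

theorem strictMono_index {c d : F.NormalChain X} {φ : c.top →* d.top}
    (hφ : Function.Injective φ) {f : Fin (c.length + 1) → Fin (d.length + 1)}
    (hf : ∀ i, image φ (c.term i) = d.term (f i)) : StrictMono f := by
  intro i j hij
  rw [← d.strictMono.lt_iff_lt, ← hf, ← hf]
  exact image_strictMono hφ (c.term_le_top j) (c.strictMono hij)

theorem Maps.length_le {c d : F.NormalChain X} (h : c.Maps d) : c.length ≤ d.length := by
  obtain ⟨φ, hφ, h1⟩ := h
  choose f hf using h1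
  have := Fintype.card_le_of_injective f (strictMono_index (F.injective hφ) hf).injective
  simpa using this

theorem Maps.isomorphic {c d : F.NormalChain X} (h : c.Maps d) (hl : c.length = d.length) :
    c.Isomorphic d := by
  obtain ⟨φ, hφ, h1⟩ := h
  choose f hf using h1
  have hmono := strictMono_index (F.injective hφ) hf
  have hfc : ∀ i, f i = Fin.cast (congrArg (· + 1) hl) i := by
    have hg : StrictMono fun i => Fin.cast (congrArg (· + 1) hl.symm) (f i) :=
      fun i j hij => hmono hij
    intro i
    have h2 := le_antisymm (hg.apply_le (x := i)) hg.le_apply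
    exact Fin.ext (show (f i).val = i.val from congrArg Fin.val h2)
  have htop : image φ c.top = d.top := by
    refine (hf (Fin.last _)).trans ?_
    rw [hfc]
    exact congrArg d.term (Fin.ext hl)
  obtain ⟨R, hR, e, he, he', rfl⟩ := F.exists_factor hφ
  have hRd : R = d.top := by
    refine le_antisymm hR fun y hy => ?_
    rw [← htop] at hy
    obtain ⟨x, -, rfl⟩ := mem_image.1 hy
    exact (e x).2
  subst hRd
  refine ⟨hl, e, ⟨he, he'⟩, fun i => ?_⟩
  rw [← hfc i, ← hf i]
  rfl

theorem Maps.antisymm {c d : F.NormalChain X} (h : c.Maps d) (h' : d.Maps c) : c.Isomorphic d :=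
  h.isomorphic (le_antisymm h.length_le h'.length_le)

instance setoid (F : FusionSystem S) (X : Set (Subgroup S)) : Setoid (F.NormalChain X) where
  r := Isomorphic
  iseqv := ⟨Isomorphic.refl, Isomorphic.symm, Isomorphic.trans⟩

end NormalChain

/-- The set of `F`-isomorphism classes of normal chains of subgroups in the collection `X`. -/
def NormalChainClass (F : FusionSystem S) (X : Set (Subgroup S)) : Type u :=
  Quotient (NormalChain.setoid F X)

/-- The isomorphism classes form a poset: `[c] ≤ [d]` if there is a morphism from `c` to `d`. -/
instance (F : FusionSystem S) (X : Set (Subgroup S)) : PartialOrder (F.NormalChainClass X) where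
  le := Quotient.lift₂ NormalChain.Maps fun _ _ _ _ h h' => propext
    ⟨fun k => (h.symm.maps.trans k).trans h'.maps, fun k => (h.maps.trans k).trans h'.symm.maps⟩
  le_refl := by
    rintro ⟨c⟩
    exact NormalChain.Maps.refl c
  le_trans := by
    rintro ⟨a⟩ ⟨b⟩ ⟨c⟩
    exact NormalChain.Maps.trans
  le_antisymm := by
    rintro ⟨a⟩ ⟨b⟩ h h'
    exact Quotient.sound (NormalChain.Maps.antisymm h h')

end FusionSystem

/-!
The poset of isomorphism classes of normal chains is acyclic because it can be built up from the
class of the one-term chain `S`, one element at a time, by attaching each new element along a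
contractible link. This is a discrete Morse matching with a single critical cell. It works for any
collection of subgroups that contains `S` and is closed under passing to targets of morphisms of the
fusion system, in particular for all subgroups and for all non-trivial subgroups.

For a chain `c` let `N(c)` be the intersection of the normalizers in `S` of its terms; since the
terms are normal in the largest one, `N(c)` contains the top of `c`. The *height* of a class is the
largest order of `N(c)` for `c` in the class. By Sylow's theorem and the extension axiom, every
class has a representative `d` such that each representative `c` admits a morphism `N(c) → N(d)` of
the fusion system carrying `c` to `d` (`NormalChain.exists_fullyNormalized`); in particular `N(d)`
has maximal order, and if `N(c)` has maximal order too then this morphism is an isomorphism. So the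
class of `d ∪ {N(d)}` depends only on the class of `d`, and it has the same height because
`N(d ∪ {N(d)}) = N(d)`. A class that contains a chain whose top has the order of the height is
called full. The matching pairs each class that is not full with the full class
`[d ∪ {N(d)}]`, and the only full class left over is that of `S`: if `c ∪ {T}` represents a full
class of height `|T|`, then `c` has height `|T|` as well, because proper subgroups of `p`-groups are
properly contained in their normalizers (`height_eq_of_snoc`).

The classes are added by decreasing height; among those of one height, the full ones come first, and
then the shorter ones. The part already present of the link of a full class `[c]` with top `T`
consists of classes of proper subchains and is contracted by adding `T`, since the one subchain for
which this would give all of `c` is absent (`acyclic_link_of_isFull`). In the link of a class `[d]`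
that is not full, every element is comparable with `[d ∪ {N(d)}]` (`acyclic_link_of_not_isFull`).

Acyclicity is expressed by augmented integral cochains on weakly monotone tuples, for which adding
an element with acyclic link is a Mayer-Vietoris argument (`PosetCochain.Acyclic.of_link`). These
cochains compute the cohomology of the nerve
(`PosetCochain.Acyclic.subsingleton_integerCohomology`,
`PosetCochain.Acyclic.nonempty_integerCohomology_zero`).
-/

/-! ### Cochains on the chains of a poset -/

namespace PosetCochain

variable {P : Type u}

/-- The alternating sum over the faces of a tuple. Cochains are functions on all `k`-tuples of
vertices, and `k = 0` is allowed: the value at the empty tuple is the augmentation term. -/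
def coboundary {k : ℕ} (f : (Fin k → P) → ℤ) (σ : Fin (k + 1) → P) : ℤ :=
  ∑ i : Fin (k + 1), (-1) ^ (i : ℕ) * f (i.removeNth σ)

theorem coboundary_coboundary {k : ℕ} (f : (Fin k → P) → ℤ) (σ : Fin (k + 2) → P) :
    coboundary (coboundary f) σ = 0 := by
  simp only [coboundary, Finset.mul_sum]
  rw [← Finset.sum_product']
  refine Finset.sum_involution (fun ij _ => (ij.1.succAbove ij.2, ij.2.predAbove ij.1))
    ?_ ?_ (fun _ _ => Finset.mem_product.2 ⟨Finset.mem_univ _, Finset.mem_univ _⟩) ?_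
  · rintro ⟨i, j⟩ -
    have h := Fin.neg_one_pow_succAbove_add_predAbove (R := ℤ) i j
    have h2 := Fin.removeNth_removeNth_eq_swap σ j i
    rw [pow_add] at h
    dsimp only
    rw [← mul_assoc, ← mul_assoc, h, ← h2, pow_add]
    ring
  · rintro ⟨i, j⟩ - - h
    exact Fin.succAbove_ne i j (congrArg Prod.fst h)
  · rintro ⟨i, j⟩ -
    exact Prod.ext (Fin.succAbove_succAbove_predAbove i j) (Fin.predAbove_predAbove_succAbove i j)

theorem coboundary_sub {k : ℕ} (f g : (Fin k → P) → ℤ) (σ : Fin (k + 1) → P) :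
    coboundary (fun τ => f τ - g τ) σ = coboundary f σ - coboundary g σ := by
  simp only [coboundary, mul_sub, Finset.sum_sub_distrib]

variable [PartialOrder P]

/-- Weakly decreasing tuples of elements of `T`. -/
def IsSimplex (T : Set P) {k : ℕ} (σ : Fin k → P) : Prop :=
  Antitone σ ∧ ∀ i, σ i ∈ T

theorem IsSimplex.removeNth {T : Set P} {k : ℕ} {σ : Fin (k + 1) → P} (h : IsSimplex T σ)
    (i : Fin (k + 1)) : IsSimplex T (i.removeNth σ) :=
  ⟨fun _ _ hab => h.1 ((Fin.strictMono_succAbove i).monotone hab), fun _ => h.2 _⟩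

theorem IsSimplex.mono {T T' : Set P} (hT : T ⊆ T') {k : ℕ} {σ : Fin k → P}
    (h : IsSimplex T σ) : IsSimplex T' σ :=
  ⟨h.1, fun i => hT (h.2 i)⟩

theorem coboundary_congr {T : Set P} {k : ℕ} {f g : (Fin k → P) → ℤ}
    (h : ∀ τ, IsSimplex T τ → f τ = g τ) {σ : Fin (k + 1) → P} (hσ : IsSimplex T σ) :
    coboundary f σ = coboundary g σ :=
  Finset.sum_congr rfl fun i _ => by rw [h _ (hσ.removeNth i)]

/-- The reduced integral cohomology of the order complex of `T` vanishes in all degrees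
(including degree `-1`, whence the nonemptiness). -/
def Acyclic (T : Set P) : Prop :=
  T.Nonempty ∧ ∀ (k : ℕ) (f : (Fin (k + 1) → P) → ℤ),
    (∀ σ, IsSimplex T σ → coboundary f σ = 0) →
      ∃ g : (Fin k → P) → ℤ, ∀ σ, IsSimplex T σ → coboundary g σ = f σ

/-- A poset with a greatest element is a cone. -/
theorem acyclic_of_isGreatest {T : Set P} {x : P} (hx : IsGreatest T x) : Acyclic T := by
  refine ⟨⟨x, hx.1⟩, fun k f hf => ⟨fun σ => f (Fin.cons x σ), fun σ hσ => ?_⟩⟩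
  have hs : IsSimplex T (Fin.cons x σ : Fin (k + 2) → P) := by
    constructor
    · intro i j
      refine Fin.cases (fun _ => ?_) (fun i hij => ?_) i
      · refine Fin.cases le_rfl (fun j => ?_) j
        exact hx.2 (hσ.2 j)
      · revert hij
        refine Fin.cases (fun h => ?_) (fun j h => ?_) j
        · exact absurd h (not_le.2 (Fin.succ_pos i))
        · exact hσ.1 (Fin.succ_le_succ_iff.1 h)
    · exact fun i => Fin.cases hx.1 hσ.2 i
  have h := hf _ hs
  rw [coboundary, Fin.sum_univ_succ] at h
  have h1 : ∀ i : Fin (k + 1), (i.succ.removeNth (Fin.cons x σ : Fin (k + 2) → P)) =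
      Fin.cons x (i.removeNth σ) := by
    intro i
    funext j
    refine Fin.cases ?_ (fun j => ?_) j
    · simp [Fin.removeNth]
    · simp [Fin.removeNth]
  have h0 : (Fin.removeNth 0 (Fin.cons x σ : Fin (k + 2) → P)) = σ := by
    funext j
    simp [Fin.removeNth]
  simp only [h1, h0, Fin.val_zero, pow_zero, one_mul, Fin.val_succ, pow_succ, mul_neg, mul_one,
    neg_mul, Finset.sum_neg_distrib] at h
  rw [coboundary]
  linarith

/-- The Mayer-Vietoris argument for the order complexes of two subposets that contain all the
simplices. -/
theorem Acyclic.of_cover {T A B : Set P} (hA : Acyclic A) (hB : Acyclic B)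
    (hAB : Acyclic (A ∩ B)) (hAT : A ⊆ T) (hBT : B ⊆ T)
    (h : ∀ (k : ℕ) (σ : Fin k → P), IsSimplex T σ → IsSimplex A σ ∨ IsSimplex B σ) :
    Acyclic T := by
  classical
  refine ⟨hA.1.mono hAT, fun k f hf => ?_⟩
  obtain ⟨a, ha⟩ := hA.2 k f fun σ hσ => hf σ (hσ.mono hAT)
  obtain ⟨b, hb⟩ := hB.2 k f fun σ hσ => hf σ (hσ.mono hBT)
  have hab : ∀ σ, IsSimplex (A ∩ B) σ → coboundary (fun τ => a τ - b τ) σ = 0 := fun σ hσ => by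
    rw [coboundary_sub, ha σ (hσ.mono Set.inter_subset_left),
      hb σ (hσ.mono Set.inter_subset_right), sub_self]
  -- It suffices to change `a` by a cocycle so that it agrees with `b` on the intersection.
  obtain ⟨a', ha', hab'⟩ : ∃ a' : (Fin k → P) → ℤ,
      (∀ σ, IsSimplex A σ → coboundary a' σ = f σ) ∧ ∀ τ, IsSimplex (A ∩ B) τ → a' τ = b τ := by
    cases k with
    | zero =>
      refine ⟨a, ha, fun τ _ => ?_⟩
      obtain ⟨x, hx⟩ := hAB.1
      have h0 := hab (fun _ => x) ⟨fun _ _ _ => le_rfl, fun _ => hx⟩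
      rw [coboundary, Fin.sum_univ_one, Fin.val_zero, pow_zero, one_mul] at h0
      rw [Subsingleton.elim τ (Fin.removeNth 0 fun _ => x)]
      exact sub_eq_zero.1 h0
    | succ k =>
      obtain ⟨c, hc⟩ := hAB.2 k _ hab
      refine ⟨fun τ => a τ - coboundary c τ, fun σ hσ => ?_, fun τ hτ => ?_⟩
      · rw [coboundary_sub, coboundary_coboundary, ha σ hσ, sub_zero]
      · exact (congrArg (a τ - ·) (hc τ hτ)).trans (sub_sub_cancel _ _)
  refine ⟨fun τ => if IsSimplex A τ then a' τ else b τ, fun σ hσ => ?_⟩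
  rcases h _ σ hσ with hσ | hσ
  · rw [← ha' σ hσ]
    exact coboundary_congr (fun τ hτ => if_pos hτ) hσ
  · rw [← hb σ hσ]
    refine coboundary_congr (fun τ hτ => ?_) hσ
    split_ifs with hτA
    · exact hab' τ ⟨hτA.1, fun i => ⟨hτA.2 i, hτ.2 i⟩⟩
    · rfl

variable [Finite P]

/-- A poset is contractible to any element that is comparable with all its elements. -/
theorem acyclic_of_forall_comparable {T : Set P} {x : P} (hx : x ∈ T)
    (h : ∀ y ∈ T, y ≤ x ∨ x ≤ y) : Acyclic T := by
  induction hn : T.ncard using Nat.strong_induction_on generalizing T with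
  | _ n ih =>
  by_cases hg : ∀ y ∈ T, y ≤ x
  · exact acyclic_of_isGreatest ⟨hx, hg⟩
  push Not at hg
  obtain ⟨v, hvT, hv⟩ := hg
  obtain ⟨u, hvu, hu⟩ := (Set.toFinite T).exists_le_maximal hvT
  have hxu : x < u := lt_of_le_not_ge (((h v hvT).resolve_left hv).trans hvu)
    fun hux => hv (hvu.trans hux)
  have hlt : (T \ {u}).ncard < n := hn ▸ Set.ncard_sdiff_singleton_lt_of_mem hu.1 (Set.toFinite T)
  have hAB : Acyclic ((T \ {u}) ∩ {y ∈ T | y ≤ u}) :=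
    ih _ ((Set.ncard_le_ncard Set.inter_subset_left).trans_lt hlt)
      (T := (T \ {u}) ∩ {y ∈ T | y ≤ u}) ⟨⟨hx, hxu.ne⟩, hx, hxu.le⟩ (fun y hy => h y hy.1.1) rfl
  refine Acyclic.of_cover (B := {y ∈ T | y ≤ u})
    (ih _ hlt (T := T \ {u}) ⟨hx, hxu.ne⟩ (fun y hy => h y hy.1) rfl)
    (acyclic_of_isGreatest (x := u) ⟨⟨hu.1, le_rfl⟩, fun y hy => hy.2⟩) hAB Set.sdiff_subset
    (Set.sep_subset _ _) fun k σ hσ => ?_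
  by_cases hm : ∃ i, σ i = u
  · obtain ⟨i, hi⟩ := hm
    refine Or.inr ⟨hσ.1, fun j => ⟨hσ.2 j, ?_⟩⟩
    rcases le_total i j with hij | hij
    · exact hi ▸ hσ.1 hij
    · exact hu.2 (hσ.2 j) (hi ▸ hσ.1 hij)
  · push Not at hm
    exact Or.inl ⟨hσ.1, fun j => ⟨hσ.2 j, hm j⟩⟩

/-- Adding an element with acyclic link to an acyclic poset. -/
theorem Acyclic.of_link {T : Set P} {x : P} (hx : x ∈ T) (h : Acyclic (T \ {x}))
    (hl : Acyclic {y ∈ T | y ≠ x ∧ (y ≤ x ∨ x ≤ y)}) : Acyclic T := by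
  refine Acyclic.of_cover (B := {y ∈ T | y ≤ x ∨ x ≤ y}) h
    (acyclic_of_forall_comparable (x := x) ⟨hx, Or.inl le_rfl⟩ fun y hy => hy.2) ?_
    Set.sdiff_subset (Set.sep_subset _ _) fun k σ hσ => ?_
  · convert hl using 1
    ext y
    simp only [Set.mem_inter_iff, Set.mem_sdiff, Set.mem_singleton_iff, Set.mem_ofPred_eq]
    tauto
  by_cases hm : ∃ i, σ i = x
  · obtain ⟨i, hi⟩ := hm
    refine Or.inr ⟨hσ.1, fun j => ⟨hσ.2 j, ?_⟩⟩
    exact (le_total i j).imp (fun hij => hi ▸ hσ.1 hij) fun hij => hi ▸ hσ.1 hij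
  · push Not at hm
    exact Or.inl ⟨hσ.1, fun j => ⟨hσ.2 j, hm j⟩⟩

/-- If `t ∈ T` has a join in `T` with every element of `T`, then `T` is conically contractible:
`y ≤ y ⊔ t ≥ t`. -/
theorem acyclic_of_forall_isLeast {T : Set P} {t : P} (ht : t ∈ T)
    (h : ∀ y ∈ T, ∃ z, IsLeast {w ∈ T | y ≤ w ∧ t ≤ w} z) : Acyclic T := by
  induction hn : T.ncard using Nat.strong_induction_on generalizing T with
  | _ n ih =>
  by_cases hg : ∀ y ∈ T, t ≤ y
  · exact acyclic_of_forall_comparable ht fun y hy => Or.inr (hg y hy)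
  push Not at hg
  obtain ⟨v, hvT, hv⟩ := hg
  obtain ⟨x, -, hx⟩ := (Set.toFinite {y ∈ T | ¬ t ≤ y}).exists_le_maximal ⟨hvT, hv⟩
  -- By maximality of `x`, its join with `t` is the least element above `x`.
  obtain ⟨z, hz, hzl⟩ := h x hx.1.1
  have hzx : z ≠ x := fun he => hx.1.2 (he ▸ hz.2.2)
  have hxT : ∀ {y}, y ∈ T → t ≤ y → y ∈ T \ {x} := fun hy hty =>
    ⟨hy, fun he => hx.1.2 (Set.mem_singleton_iff.1 he ▸ hty)⟩
  refine Acyclic.of_link hx.1.1 (ih _ (hn ▸ Set.ncard_sdiff_singleton_lt_of_mem hx.1.1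
    (Set.toFinite T)) (hxT ht le_rfl) (fun y hy => ?_) rfl) ?_
  · obtain ⟨w, hw, hwl⟩ := h y hy.1
    exact ⟨w, ⟨hxT hw.1 hw.2.2, hw.2⟩, fun w' hw' => hwl ⟨hw'.1.1, hw'.2⟩⟩
  · refine acyclic_of_forall_comparable (x := z) ⟨hz.1, hzx, Or.inr hz.2.1⟩ ?_
    rintro y ⟨hy, hyx, hyx' | hyx'⟩
    · exact Or.inl (hyx'.trans hz.2.1)
    · by_cases hty : t ≤ y
      · exact Or.inr (hzl ⟨hy, hyx', hty⟩)
      · exact absurd (le_antisymm (hx.2 ⟨hy, hty⟩ hyx') hyx') hyx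

/-- A finite poset can be built up from one element `a` by adding its elements in the order of a
function `key`; it is acyclic if all the links met on the way are acyclic. -/
theorem acyclic_univ_of_links {K : Type*} [LinearOrder K] (key : P → K) (a : P)
    (ha : ∀ x, key a ≤ key x) (hkey : ∀ x y, x < y → key x ≠ key y)
    (h : ∀ x, x ≠ a → Acyclic {y | (y ≤ x ∨ x ≤ y) ∧ key y < key x}) :
    Acyclic (Set.univ : Set P) := by
  suffices H : ∀ (n : ℕ) (T : Set P), a ∈ T → T.ncard = n →
      (∀ x ∈ T, ∀ y, key y < key x → y ∈ T) → Acyclic T from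
    H _ _ (Set.mem_univ a) rfl fun _ _ _ _ => Set.mem_univ _
  intro n
  induction n using Nat.strong_induction_on with
  | _ n ih =>
  intro T haT hn hT
  by_cases hTa : T ⊆ {a}
  · exact acyclic_of_forall_comparable haT fun y hy => Or.inl (hTa hy).le
  obtain ⟨v, hvT, hva⟩ := Set.not_subset.1 hTa
  obtain ⟨x, ⟨hxT, hxa⟩, hx⟩ :=
    Set.exists_max_image (T \ {a}) key (Set.toFinite _) ⟨v, hvT, hva⟩
  have hmax : ∀ y ∈ T, key y ≤ key x := fun y hy => by
    by_cases hya : y = a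
    · exact hya ▸ ha x
    · exact hx y ⟨hy, hya⟩
  refine Acyclic.of_link hxT (ih _ (hn ▸ Set.ncard_sdiff_singleton_lt_of_mem hxT
    (Set.toFinite T)) _ ⟨haT, fun he => hxa he.symm⟩ rfl fun y hy z hz =>
      ⟨hT y hy.1 z hz, fun he => ?_⟩) ?_
  · exact absurd (hmax y hy.1) (not_le.2 (Set.mem_singleton_iff.1 he ▸ hz))
  · convert h x hxa using 1
    ext y
    constructor
    · rintro ⟨hy, hyx, hc⟩
      refine ⟨hc, lt_of_le_of_ne (hmax y hy) ?_⟩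
      rcases hc with hc | hc
      · exact hkey y x (lt_of_le_of_ne hc hyx)
      · exact (hkey x y (lt_of_le_of_ne hc (Ne.symm hyx))).symm
    · rintro ⟨hc, hk⟩
      exact ⟨hT x hxT y hk, fun he => hk.ne (congrArg key he), hc⟩

end PosetCochain

/-! ### Comparison with the cohomology of the nerve -/

namespace PosetCochain

variable {P : Type u} [PartialOrder P]

/-- The tuple of vertices of a simplex of the nerve of `Pᵒᵈ`, as a weakly decreasing tuple of
elements of `P`. -/
def vertices {n : ℕ} (σ : ComposableArrows Pᵒᵈ n) (i : Fin (n + 1)) : P :=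
  OrderDual.ofDual (σ.obj i)

theorem antitone_vertices {n : ℕ} (σ : ComposableArrows Pᵒᵈ n) : Antitone (vertices σ) :=
  fun _ _ h => leOfHom (σ.map (homOfLE h))

/-- The simplex of the nerve of `Pᵒᵈ` with a given weakly decreasing tuple of vertices. -/
def simplex {n : ℕ} {τ : Fin (n + 1) → P} (h : Antitone τ) : ComposableArrows Pᵒᵈ n :=
  Monotone.functor (f := fun i => OrderDual.toDual (τ i)) fun _ _ hij => h hij

theorem vertices_simplex {n : ℕ} {τ : Fin (n + 1) → P} (h : Antitone τ) :
    vertices (simplex h) = τ := rfl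

theorem vertices_injective {n : ℕ} :
    Function.Injective (vertices : ComposableArrows Pᵒᵈ n → Fin (n + 1) → P) := fun _ _ h =>
  nerve.ext_of_isThin (n := Opposite.op (SimplexCategory.mk n)) (funext fun i => congrFun h i)

theorem isSimplex_vertices {n : ℕ} (σ : ComposableArrows Pᵒᵈ n) :
    IsSimplex Set.univ (vertices σ) :=
  ⟨antitone_vertices σ, fun _ => Set.mem_univ _⟩

theorem integerCochains_d_apply (n : ℕ) (f : (integerCochains Pᵒᵈ).X n)
    (σ : ComposableArrows Pᵒᵈ (n + 1)) :
    ((integerCochains Pᵒᵈ).d n (n + 1)).hom f σ =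
      ∑ i : Fin (n + 2), (-1) ^ (i : ℕ) * f ((nerve Pᵒᵈ).δ i σ) := by
  let X := integerCosimplicial Pᵒᵈ
  let D : Fin (n + 2) → (X.obj (SimplexCategory.mk n) ⟶ X.obj (SimplexCategory.mk (n + 1))) :=
    fun i => (-1 : ℤ) ^ (i : ℕ) • X.δ i
  have h : (integerCochains Pᵒᵈ).d n (n + 1) = ∑ i, D i :=
    CochainComplex.of_d (fun n => X.obj (SimplexCategory.mk n))
      (AlgebraicTopology.AlternatingCofaceMapComplex.objD X) n
  have h1 : ((integerCochains Pᵒᵈ).d n (n + 1)).hom f = ∑ i, (D i).hom f := by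
    rw [h]
    exact (congrArg (fun l => l f) (ModuleCat.hom_sum D Finset.univ)).trans
      (LinearMap.sum_apply _ _ _)
  rw [h1]
  exact Finset.sum_apply σ Finset.univ fun i => (D i).hom f

/-- The cochain on the nerve given by a function of the vertices. -/
def toCochain {n : ℕ} (f : (Fin (n + 1) → P) → ℤ) : (integerCochains Pᵒᵈ).X n :=
  fun σ : ComposableArrows Pᵒᵈ n => f (vertices σ)

theorem d_toCochain {n : ℕ} (f : (Fin (n + 1) → P) → ℤ) :
    ((integerCochains Pᵒᵈ).d n (n + 1)).hom (toCochain f) = toCochain (coboundary f) :=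
  funext fun σ => integerCochains_d_apply n _ σ

open Classical in
theorem exists_toCochain_eq {n : ℕ} (f : (integerCochains Pᵒᵈ).X n) :
    ∃ g : (Fin (n + 1) → P) → ℤ, toCochain g = f := by
  refine ⟨fun τ => if h : Antitone τ then f (simplex h) else 0, ?_⟩
  funext (σ : ComposableArrows Pᵒᵈ n)
  refine (dif_pos (antitone_vertices σ)).trans ?_
  exact congrArg f (vertices_injective (vertices_simplex _))

theorem coboundary_eq_zero_of_d_eq_zero {n : ℕ} {g : (Fin (n + 1) → P) → ℤ}
    (h : ((integerCochains Pᵒᵈ).d n (n + 1)).hom (toCochain g) = 0) (σ : Fin (n + 2) → P)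
    (hσ : IsSimplex Set.univ σ) : coboundary g σ = 0 := by
  rw [d_toCochain] at h
  exact congrFun h (simplex hσ.1)

/-- Vanishing of the cohomology of the nerve in positive degrees. -/
theorem Acyclic.subsingleton_integerCohomology (hP : Acyclic (Set.univ : Set P)) {n : ℕ}
    (hn : 1 ≤ n) : Subsingleton (integerCohomology Pᵒᵈ n) := by
  obtain ⟨n, rfl⟩ : ∃ k, n = k + 1 := ⟨n - 1, by lia⟩
  refine ModuleCat.subsingleton_of_isZero
    ((HomologicalComplex.exactAt_iff_isZero_homology _ _).1 ?_)
  rw [HomologicalComplex.exactAt_iff' _ n (n + 1) (n + 2) (by simp) (by simp),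
    ShortComplex.moduleCat_exact_iff]
  intro (f : (integerCochains Pᵒᵈ).X (n + 1)) hf
  obtain ⟨g, rfl⟩ := exists_toCochain_eq f
  obtain ⟨e, he⟩ := hP.2 (n + 1) g (coboundary_eq_zero_of_d_eq_zero hf)
  exact ⟨toCochain e, (d_toCochain e).trans (funext fun σ => he _ (isSimplex_vertices σ))⟩

/-- In degree `0` the cocycles are the constant functions. -/
theorem Acyclic.nonempty_integerCohomology_zero (hP : Acyclic (Set.univ : Set P)) :
    Nonempty (integerCohomology Pᵒᵈ 0 ≃ₗ[ℤ] ℤ) := by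
  obtain ⟨x, -⟩ := hP.1
  let K := integerCochains Pᵒᵈ
  let ev : K.X 0 →ₗ[ℤ] ℤ := LinearMap.proj (φ := fun _ : ComposableArrows Pᵒᵈ 0 => ℤ)
    (simplex (τ := fun _ => x) fun _ _ _ => le_rfl)
  have hcycle : ∀ z : K.cycles 0, (K.d 0 1).hom ((K.iCycles 0).hom z) = 0 := fun z => by
    rw [← LinearMap.comp_apply, ← ModuleCat.hom_comp, K.iCycles_d]
    rfl
  have hinj : Function.Injective (K.iCycles 0).hom :=
    (ModuleCat.mono_iff_injective _).1 inferInstance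
  refine ⟨(CochainComplex.isoHomologyπ₀ K).symm.toLinearEquiv.trans
    (LinearEquiv.ofBijective (ev.comp (K.iCycles 0).hom) ⟨?_, fun c => ?_⟩)⟩
  · rw [injective_iff_map_eq_zero]
    intro z hz
    apply hinj
    rw [map_zero]
    have h0 := hcycle z
    obtain ⟨g, hg⟩ := exists_toCochain_eq ((K.iCycles 0).hom z)
    rw [LinearMap.comp_apply, ← hg] at hz
    rw [← hg] at h0 ⊢
    obtain ⟨e, he⟩ := hP.2 0 g (coboundary_eq_zero_of_d_eq_zero h0)
    -- The cochain `g` has constant value `e` at the empty tuple.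
    have hconst : ∀ σ, IsSimplex Set.univ σ → g σ = e Fin.elim0 := fun σ hσ => by
      rw [← he σ hσ, coboundary, Fin.sum_univ_one, Fin.val_zero, pow_zero, one_mul]
      exact congrArg e (Subsingleton.elim _ _)
    have hx : g (fun _ => x) = 0 := hz
    rw [hconst _ ⟨fun _ _ _ => le_rfl, fun _ => Set.mem_univ _⟩] at hx
    exact funext fun σ => (hconst _ (isSimplex_vertices σ)).trans hx
  · let one : K.X 0 := toCochain fun _ : Fin 1 → P => 1
    let k : ModuleCat.of ℤ (ULift.{u} ℤ) ⟶ K.X 0 :=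
      ModuleCat.ofHom (LinearMap.toSpanSingleton ℤ (K.X 0) one ∘ₗ
        ULift.moduleEquiv.toLinearMap)
    have hd : (K.d 0 1).hom one = 0 := by
      refine (d_toCochain (P := P) _).trans (funext fun (σ : ComposableArrows Pᵒᵈ 1) => ?_)
      change coboundary (fun _ : Fin 1 → P => 1) (vertices σ) = (0 : ℤ)
      simp [coboundary, Fin.sum_univ_two]
    have hk : k ≫ K.d 0 1 = 0 := by
      refine ModuleCat.hom_ext (LinearMap.ext fun (y : ULift ℤ) => ?_)
      change (K.d 0 1).hom (y.down • one) = 0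
      rw [map_smul, hd]
      exact smul_zero _
    refine ⟨(K.liftCycles k 1 (by simp) hk).hom ⟨c⟩, ?_⟩
    rw [LinearMap.comp_apply, ← LinearMap.comp_apply (K.iCycles 0).hom, ← ModuleCat.hom_comp,
      K.liftCycles_i]
    change c * 1 = c
    exact mul_one c

end PosetCochain

/-! ### Images and normalizers under morphisms of a fusion system -/

namespace FusionSystem

variable {S : Type u} [Group S] {F : FusionSystem S}

theorem inclusion_mem (F : FusionSystem S) {P Q : Subgroup S} (h : P ≤ Q) :
    Subgroup.inclusion h ∈ F.hom P Q :=
  F.conj_mem 1 _ fun x => by simp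

/-- Restriction of a morphism to smaller subgroups of its source and target. -/
theorem exists_restrict {P Q R T : Subgroup S} {φ : P →* Q} (hφ : φ ∈ F.hom P Q) (hR : R ≤ P)
    (hT : image φ R ≤ T) :
    ∃ ψ ∈ F.hom R T, ∀ x : R, (ψ x : S) = φ (Subgroup.inclusion hR x) := by
  obtain ⟨R', hR', e, he, -, hfac⟩ := F.exists_factor (F.comp_mem (F.inclusion_mem hR) hφ)
  have hval : ∀ x : R, (e x : S) = φ (Subgroup.inclusion hR x) := fun x =>
    congrArg Subtype.val (DFunLike.congr_fun hfac x).symm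
  have hRT : R' ≤ T := fun y hy => hT <| mem_image.2
    ⟨Subgroup.inclusion hR (e.symm ⟨y, hy⟩), (e.symm ⟨y, hy⟩).2, by
      rw [← hval, MulEquiv.apply_symm_apply]⟩
  exact ⟨_, F.comp_mem he (F.inclusion_mem hRT), hval⟩

theorem image_le {P Q : Subgroup S} (φ : P →* Q) (R : Subgroup S) : image φ R ≤ Q := by
  rintro _ ⟨x, -, rfl⟩
  exact (φ x).2

theorem image_mono {P Q : Subgroup S} (φ : P →* Q) {R T : Subgroup S} (h : R ≤ T) :
    image φ R ≤ image φ T := by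
  rintro _ ⟨x, hx, rfl⟩
  exact ⟨x, h hx, rfl⟩

theorem image_inclusion {P Q R : Subgroup S} (h : P ≤ Q) (hR : R ≤ P) :
    image (Subgroup.inclusion h) R = R := by
  ext y
  rw [mem_image]
  exact ⟨fun ⟨x, hx, hy⟩ => hy ▸ hx, fun hy => ⟨⟨y, hR hy⟩, hy, rfl⟩⟩

theorem image_restrict {P Q R T A : Subgroup S} {φ : P →* Q} {ψ : R →* T} {hR : R ≤ P}
    (h : ∀ x : R, (ψ x : S) = φ (Subgroup.inclusion hR x)) (hA : A ≤ R) :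
    image ψ A = image φ A := by
  ext y
  rw [mem_image, mem_image]
  constructor
  · rintro ⟨x, hx, rfl⟩
    exact ⟨_, hx, (h x).symm⟩
  · rintro ⟨x, hx, rfl⟩
    exact ⟨⟨x, hA hx⟩, hx, h _⟩

theorem card_image {P Q R : Subgroup S} {φ : P →* Q} (hφ : Function.Injective φ) (hR : R ≤ P) :
    Nat.card (image φ R) = Nat.card R := by
  rw [image, Subgroup.card_map_of_injective
    ((Subgroup.subtype_injective Q).comp hφ : Function.Injective (Q.subtype.comp φ))]
  exact Nat.card_congr (Subgroup.subgroupOfEquivOfLe hR).toEquiv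

theorem apply_mem_normalizer_image {P Q A : Subgroup S} (φ : P →* Q) {g : P}
    (hg : (g : S) ∈ Subgroup.normalizer (A : Set S)) :
    (φ g : S) ∈ Subgroup.normalizer (image φ A : Set S) := by
  rw [Subgroup.mem_normalizer_iff] at hg ⊢
  intro y
  constructor
  · rintro ⟨x, hx, rfl⟩
    exact ⟨g * x * g⁻¹, (hg x).1 hx, by simp⟩
  · rintro ⟨x, hx, hxy⟩
    refine ⟨g⁻¹ * x * g, (hg _).2 ?_, ?_⟩
    · have hx' : (x : S) ∈ A := hx
      simpa [mul_assoc] using hx'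
    · have hxy' : (φ x : S) = φ g * y * (φ g : S)⁻¹ := hxy
      simp [hxy', mul_assoc]

/-- A subgroup of a `p`-group that is self-normalizing in a larger subgroup equals it. -/
theorem eq_of_forall_mem_normalizer [Finite S] {p : ℕ} [Fact p.Prime] (hS : IsPGroup p S)
    {R M : Subgroup S} (hRM : R ≤ M)
    (h : ∀ g ∈ M, g ∈ Subgroup.normalizer (R : Set S) → g ∈ R) : R = M := by
  have := (hS.to_subgroup M).isNilpotent
  refine le_antisymm hRM fun y hy => ?_
  have htop : R.subgroupOf M = ⊤ := by
    refine normalizerCondition_iff_only_full_group_self_normalizing.1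
      Group.normalizerCondition_of_isNilpotent _ (le_antisymm (fun g hg => ?_)
        Subgroup.le_normalizer)
    refine h g g.2 (Subgroup.mem_normalizer_iff.2 fun x => ?_)
    rw [Subgroup.mem_normalizer_iff] at hg
    by_cases hx : x ∈ M
    · exact hg ⟨x, hx⟩
    · refine ⟨fun hxR => absurd (hRM hxR) hx, fun hxR => absurd ?_ hx⟩
      have := M.mul_mem (M.mul_mem (M.inv_mem g.2) (hRM hxR)) g.2
      simpa [mul_assoc] using this
  exact (htop ▸ Subgroup.mem_top _ : (⟨y, hy⟩ : M) ∈ R.subgroupOf M)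

/-! ### Extension of isomorphisms of families of subgroups -/

theorem exists_isIso_fullyNormalized [Finite S] (F : FusionSystem S) (P : Subgroup S) :
    ∃ (Q : Subgroup S) (e : P ≃* Q), F.IsIso e ∧ F.FullyNormalized Q := by
  obtain ⟨Q, ⟨e, he⟩, hQ⟩ := Set.exists_max_image {Q | F.Conjugate P Q}
    (fun Q => Nat.card (Subgroup.normalizer (Q : Set S))) (Set.toFinite _)
    ⟨P, MulEquiv.refl P, IsIso.refl F P⟩
  exact ⟨Q, e, he, fun R ⟨f, hf⟩ => hQ R ⟨e.trans f, he.trans hf⟩⟩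

/-- The automorphisms in `F` of `Q` that stabilize every member of a family of subgroups. -/
def autStabilizer (F : FusionSystem S) {Q : Subgroup S} {ι : Type*} {A : ι → Subgroup S}
    (hA : ∀ i, A i ≤ Q) : Subgroup (F.aut Q) where
  carrier := {α | ∀ i, image (α : MulAut Q).toMonoidHom (A i) = A i}
  one_mem' := fun i => image_id (hA i)
  mul_mem' := fun {α β} hα hβ i => (image_comp (β : MulAut Q).toMonoidHom
    (α : MulAut Q).toMonoidHom (A i)).trans (by rw [hβ i, hα i])
  inv_mem' := fun {α} hα i => by
    have h := image_symm (α : MulAut Q) (hA i)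
    rwa [hα i] at h

/-- Given subgroups `A i` of a fully normalized subgroup `Q`, an automorphism `g` of `Q` moves
them to a position in which the automorphisms of `Q` induced by conjugation in `S` contain a Sylow
`p`-subgroup of the stabilizer of the family. Then every isomorphism onto this family can be
corrected by an automorphism so that it extends to the normalizers in `S`. -/
theorem IsSaturated.exists_extend_family [Finite S] {p : ℕ} [Fact p.Prime] (hS : IsPGroup p S)
    (hF : F.IsSaturated p) {Q : Subgroup S} (hQ : F.FullyNormalized Q) {ι : Type*}
    {A : ι → Subgroup S} (hA : ∀ i, A i ≤ Q) :
    ∃ g ∈ F.aut Q, ∀ (R N : Subgroup S) (e : R ≃* Q) (C : ι → Subgroup S), F.IsIso e →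
      (∀ i, C i ≤ R) → R ≤ N → N ≤ Subgroup.normalizer (R : Set S) →
      (∀ i, N ≤ Subgroup.normalizer (C i : Set S)) →
      (∀ i, image e.toMonoidHom (C i) = image g.toMonoidHom (A i)) →
      ∃ ψ ∈ F.hom N ⊤, ∀ i, image ψ (C i) = image g.toMonoidHom (A i) := by
  obtain ⟨P₀, hP₀⟩ := hF.sylow Q hQ
  let K := F.autStabilizer hA
  obtain ⟨T⟩ : Nonempty (Sylow p K) := inferInstance
  obtain ⟨P₁, hTP₁⟩ := (T.isPGroup'.map K.subtype).exists_le_sylow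
  obtain ⟨g, hg⟩ := MulAction.exists_smul_eq (F.aut Q) P₁ P₀
  have hT : ∀ t ∈ T, ((g * t * g⁻¹ : F.aut Q) : MulAut Q) ∈ autConj Q := fun t ht => by
    have h1 : (g * t * g⁻¹ : F.aut Q) ∈ (P₀ : Subgroup (F.aut Q)) := by
      rw [← hg, Sylow.coe_subgroup_smul]
      exact Subgroup.smul_mem_pointwise_smul _ (MulAut.conj g) _ (hTP₁ ⟨t, ht, rfl⟩)
    rw [hP₀] at h1
    exact h1
  refine ⟨g, g.2, fun R N e C he hC hRN hNR hNC heC => ?_⟩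
  have hinvg : ∀ i, image (g⁻¹ : F.aut Q).1.toMonoidHom (image g.1.toMonoidHom (A i)) = A i :=
    fun i => image_symm g.1 (hA i)
  -- The action of `N` by conjugation on `R`, transported to `Q` and conjugated into `K`.
  let c : N →* MulAut R := R.normalizerMonoidHom.comp (Subgroup.inclusion hNR)
  have hc : ∀ n i, image (c n).toMonoidHom (C i) = C i := fun n i => by
    have hn := Subgroup.mem_normalizer_iff.1 (hNC i n.2)
    ext y
    rw [mem_image]
    constructor
    · rintro ⟨x, hx, rfl⟩
      exact (hn x).1 hx
    · intro hy
      have h1 : (n : S)⁻¹ * y * n ∈ C i := (hn _).2 (by simpa [mul_assoc] using hy)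
      refine ⟨⟨_, hC i h1⟩, h1, ?_⟩
      change (n : S) * (n⁻¹ * y * n) * (n : S)⁻¹ = y
      simp [mul_assoc]
  have hcF : ∀ n, F.IsIso (c n) := fun n =>
    ⟨F.conj_mem n _ fun _ => rfl, F.conj_mem (n⁻¹ : N) _ fun x => by
      rw [← MulAut.inv_def, ← map_inv]
      rfl⟩
  let θ : N →* F.aut Q := ((MulAut.congr e).toMonoidHom.comp c).codRestrict (F.aut Q)
    fun n => (he.symm.trans (hcF n)).trans he
  let θ' : N →* K := ((MulAut.conj g⁻¹).toMonoidHom.comp θ).codRestrict K fun n i => by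
    change image ((((g⁻¹ : F.aut Q).1.toMonoidHom.comp
      ((e.toMonoidHom.comp (c n).toMonoidHom).comp e.symm.toMonoidHom)).comp
        ((g⁻¹⁻¹ : F.aut Q)).1.toMonoidHom)) (A i) = A i
    rw [inv_inv, image_comp, image_comp, image_comp, image_comp, ← heC, image_symm e (hC i), hc,
      heC, hinvg]
  have hp : IsPGroup p θ'.range :=
    (hS.to_subgroup N).of_surjective θ'.rangeRestrict θ'.rangeRestrict_surjective
  obtain ⟨T', hT'⟩ := hp.exists_le_sylow
  obtain ⟨k, hk⟩ := MulAction.exists_smul_eq K T' T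
  have hkT : ∀ n, k * θ' n * k⁻¹ ∈ T := fun n => by
    rw [← hk]
    exact Subgroup.smul_mem_pointwise_smul _ (MulAut.conj k) (T' : Subgroup K) (hT' ⟨n, rfl⟩)
  -- The corrected isomorphism carries the action of `N` into that of `S`.
  let β : F.aut Q := g * k * g⁻¹
  let e' : R ≃* Q := e.trans β.1
  have hβ : ∀ n, MulAut.congr e' (c n) ∈ autConj Q := fun n => by
    have h1 : (g * (k * θ' n * k⁻¹ : K) * g⁻¹ : F.aut Q) = β * θ n * β⁻¹ := by
      change g * (k.1 * (g⁻¹ * θ n * g⁻¹⁻¹) * k.1⁻¹) * g⁻¹ =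
        g * k.1 * g⁻¹ * θ n * (g * k.1 * g⁻¹)⁻¹
      group
    have h2 := hT _ (hkT n)
    rw [h1] at h2
    exact h2
  have hNe : N ≤ extensionDomain e' := fun n hn =>
    ⟨⟨n, hNR hn⟩, hβ ⟨n, hn⟩, rfl⟩
  obtain ⟨ψ, hψ, hψe⟩ := hF.extend R Q e' (he.trans β.2) (hF.fullyCentralized Q hQ)
  refine ⟨_, F.comp_mem (F.inclusion_mem hNe) hψ, fun i => ?_⟩
  rw [image_comp, image_inclusion hNe ((hC i).trans hRN)]
  have h3 : image ψ (C i) = image e'.toMonoidHom (C i) :=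
    (image_restrict (hR := le_extensionDomain e') (fun x => (hψe x).symm) (hC i)).symm
  rw [h3]
  change image ((g.1.toMonoidHom.comp (k.1.1.toMonoidHom.comp
    (g⁻¹ : F.aut Q).1.toMonoidHom)).comp e.toMonoidHom) (C i) = _
  rw [image_comp, image_comp, image_comp, heC, hinvg, k.2 i]

end FusionSystem

/-! ### Operations on normal chains -/

namespace FusionSystem

variable {S : Type u} [Group S] {F : FusionSystem S} {X : Set (Subgroup S)}

/-- The collection `X` is closed under passing to targets of morphisms of `F`: with a subgroup it
contains all larger and all `F`-conjugate subgroups. -/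
def IsUpwardClosed (F : FusionSystem S) (X : Set (Subgroup S)) : Prop :=
  ∀ ⦃P Q : Subgroup S⦄, ∀ φ ∈ F.hom P Q, P ∈ X → Q ∈ X

theorem IsUpwardClosed.image_mem (hX : F.IsUpwardClosed X) {P Q R : Subgroup S} {φ : P →* Q}
    (hφ : φ ∈ F.hom P Q) (hR : R ≤ P) (h : R ∈ X) : image φ R ∈ X := by
  obtain ⟨ψ, hψ, -⟩ := exists_restrict hφ hR le_rfl
  exact hX ψ hψ h

namespace NormalChain

/-- The set of subgroups occurring in a chain. -/
def terms (c : F.NormalChain X) : Set (Subgroup S) := Set.range c.term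

theorem top_mem_terms (c : F.NormalChain X) : c.top ∈ c.terms := ⟨_, rfl⟩

theorem le_top {c : F.NormalChain X} {A : Subgroup S} (hA : A ∈ c.terms) : A ≤ c.top := by
  obtain ⟨i, rfl⟩ := hA
  exact c.term_le_top i

theorem total {c : F.NormalChain X} {A B : Subgroup S} (hA : A ∈ c.terms) (hB : B ∈ c.terms) :
    A ≤ B ∨ B ≤ A := by
  obtain ⟨i, rfl⟩ := hA
  obtain ⟨j, rfl⟩ := hB
  exact (le_total i j).imp (c.strictMono.monotone ·) (c.strictMono.monotone ·)

/-- A chain contains at most one subgroup of each order. -/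
theorem eq_of_card_eq [Finite S] {c : F.NormalChain X} {A B : Subgroup S} (hA : A ∈ c.terms)
    (hB : B ∈ c.terms) (h : Nat.card A = Nat.card B) : A = B := by
  rcases total hA hB with hAB | hAB
  · exact Subgroup.eq_of_le_of_card_ge hAB h.ge
  · exact (Subgroup.eq_of_le_of_card_ge hAB h.le).symm

theorem maps_of_image_mem {c d : F.NormalChain X} {P Q : Subgroup S} {φ : P →* Q}
    (hφ : φ ∈ F.hom P Q) (hc : c.top ≤ P) (h : ∀ A ∈ c.terms, image φ A ∈ d.terms) :
    c.Maps d := by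
  obtain ⟨ψ, hψ, hval⟩ := exists_restrict hφ hc (le_top (h _ c.top_mem_terms))
  refine ⟨ψ, hψ, fun i => ?_⟩
  obtain ⟨j, hj⟩ := h _ ⟨i, rfl⟩
  exact ⟨j, (image_restrict hval (c.term_le_top i)).trans hj.symm⟩

theorem maps_of_terms_subset {c d : F.NormalChain X} (h : c.terms ⊆ d.terms) : c.Maps d :=
  maps_of_image_mem (F.inclusion_mem (le_top (h c.top_mem_terms))) le_rfl fun A hA => by
    rw [image_inclusion _ (le_top hA)]
    exact h hA

theorem Maps.exists_image {c d : F.NormalChain X} (h : c.Maps d) :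
    ∃ φ ∈ F.hom c.top d.top, ∀ A ∈ c.terms, image φ A ∈ d.terms := by
  obtain ⟨φ, hφ, h⟩ := h
  refine ⟨φ, hφ, ?_⟩
  rintro _ ⟨i, rfl⟩
  obtain ⟨j, hj⟩ := h i
  exact ⟨j, hj.symm⟩

theorem Isomorphic.card_top {c d : F.NormalChain X} (h : c.Isomorphic d) :
    Nat.card c.top = Nat.card d.top := by
  obtain ⟨-, e, -⟩ := h
  exact Nat.card_congr e.toEquiv

/-- The image of a chain under a morphism of `F`. -/
def map (hX : F.IsUpwardClosed X) (c : F.NormalChain X) {P Q : Subgroup S} {φ : P →* Q}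
    (hφ : φ ∈ F.hom P Q) (hc : c.top ≤ P) : F.NormalChain X where
  length := c.length
  term i := image φ (c.term i)
  strictMono _ j hij :=
    image_strictMono (F.injective hφ) ((c.term_le_top j).trans hc) (c.strictMono hij)
  mem i := hX.image_mem hφ ((c.term_le_top i).trans hc) (c.mem i)
  normal i := by
    refine (Subgroup.normal_subgroupOf_iff_le_normalizer
      (image_mono φ (c.term_le_top i))).2 ?_
    rintro _ ⟨x, hx, rfl⟩
    exact apply_mem_normalizer_image φ
      ((Subgroup.normal_subgroupOf_iff_le_normalizer (c.term_le_top i)).1 (c.normal i) hx)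

theorem isomorphic_map (hX : F.IsUpwardClosed X) (c : F.NormalChain X) {P Q : Subgroup S}
    {φ : P →* Q} (hφ : φ ∈ F.hom P Q) (hc : c.top ≤ P) : c.Isomorphic (c.map hX hφ hc) :=
  (maps_of_image_mem hφ hc (by rintro _ ⟨i, rfl⟩; exact ⟨i, rfl⟩)).isomorphic rfl

/-- The chain consisting of one subgroup. -/
def single (F : FusionSystem S) {T : Subgroup S} (hT : T ∈ X) : F.NormalChain X where
  length := 0
  term _ := T
  strictMono i j hij := absurd (Subsingleton.elim (α := Fin 1) i j) hij.ne
  mem _ := hT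
  normal _ := by
    rw [Subgroup.subgroupOf_self]
    infer_instance

theorem mem_terms_single {T : Subgroup S} (hT : T ∈ X) {A : Subgroup S} :
    A ∈ (single F hT).terms ↔ A = T :=
  ⟨fun ⟨_, hi⟩ => hi.symm, fun h => ⟨0, h.symm⟩⟩

/-- The intersection of the normalizers in `S` of the terms of a chain. -/
def normalizer (c : F.NormalChain X) : Subgroup S :=
  ⨅ A ∈ c.terms, Subgroup.normalizer (A : Set S)

theorem le_normalizer_iff {c : F.NormalChain X} {H : Subgroup S} :
    H ≤ c.normalizer ↔ ∀ A ∈ c.terms, H ≤ Subgroup.normalizer (A : Set S) :=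
  le_iInf₂_iff

theorem mem_normalizer_iff {c : F.NormalChain X} {g : S} :
    g ∈ c.normalizer ↔ ∀ A ∈ c.terms, g ∈ Subgroup.normalizer (A : Set S) := by
  simp only [normalizer, Subgroup.mem_iInf]

theorem normalizer_le {c : F.NormalChain X} {A : Subgroup S} (hA : A ∈ c.terms) :
    c.normalizer ≤ Subgroup.normalizer (A : Set S) :=
  iInf₂_le A hA

theorem normalizer_anti {c d : F.NormalChain X} (h : c.terms ⊆ d.terms) :
    d.normalizer ≤ c.normalizer :=
  le_normalizer_iff.2 fun _ hA => normalizer_le (h hA)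

theorem top_le_normalizer (c : F.NormalChain X) : c.top ≤ c.normalizer := by
  refine le_normalizer_iff.2 ?_
  rintro _ ⟨i, rfl⟩
  exact (Subgroup.normal_subgroupOf_iff_le_normalizer (c.term_le_top i)).1 (c.normal i)

/-- Adding a new largest term to a chain. -/
def snoc (c : F.NormalChain X) {T : Subgroup S} (hT : T ∈ X) (hlt : c.top < T)
    (hn : T ≤ c.normalizer) : F.NormalChain X where
  length := c.length + 1
  term := Fin.snoc (α := fun _ => Subgroup S) c.term T
  strictMono i j := by
    refine Fin.lastCases (fun h => absurd (Fin.le_last j) (not_le.2 h)) (fun i => ?_) i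
    refine Fin.lastCases (fun _ => ?_) (fun j h => ?_) j
    · rw [Fin.snoc_castSucc, Fin.snoc_last]
      exact (c.term_le_top i).trans_lt hlt
    · rw [Fin.snoc_castSucc, Fin.snoc_castSucc]
      exact c.strictMono (Fin.castSucc_lt_castSucc_iff.1 h)
  mem i := by
    refine Fin.lastCases ?_ (fun i => ?_) i
    · rwa [Fin.snoc_last]
    · rw [Fin.snoc_castSucc]
      exact c.mem i
  normal i := by
    rw [Fin.snoc_last]
    refine Fin.lastCases ?_ (fun i => ?_) i
    · rw [Fin.snoc_last, Subgroup.subgroupOf_self]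
      infer_instance
    · rw [Fin.snoc_castSucc,
        Subgroup.normal_subgroupOf_iff_le_normalizer ((c.term_le_top i).trans hlt.le)]
      exact le_normalizer_iff.1 hn _ ⟨i, rfl⟩

section Snoc

variable (c : F.NormalChain X) {T : Subgroup S} (hT : T ∈ X) (hlt : c.top < T)
  (hn : T ≤ c.normalizer)

theorem top_snoc : (c.snoc hT hlt hn).top = T :=
  Fin.snoc_last (α := fun _ => Subgroup S) T c.term

theorem terms_snoc : (c.snoc hT hlt hn).terms = insert T c.terms := by
  ext A
  constructor
  · rintro ⟨i, rfl⟩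
    refine Fin.lastCases (Or.inl (c.top_snoc hT hlt hn)) (fun i => Or.inr ⟨i, ?_⟩) i
    exact (Fin.snoc_castSucc (α := fun _ => Subgroup S) T c.term i).symm
  · rintro (rfl | ⟨i, rfl⟩)
    · exact ⟨_, c.top_snoc hT hlt hn⟩
    · exact ⟨i.castSucc, Fin.snoc_castSucc (α := fun _ => Subgroup S) T c.term i⟩

theorem maps_snoc : c.Maps (c.snoc hT hlt hn) :=
  maps_of_terms_subset (c.terms_snoc hT hlt hn ▸ Set.subset_insert _ _)

theorem mem_normalizer_snoc {g : S} (hg : g ∈ c.normalizer)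
    (hgT : g ∈ Subgroup.normalizer (T : Set S)) : g ∈ (c.snoc hT hlt hn).normalizer := by
  refine mem_normalizer_iff.2 fun A hA => ?_
  rw [terms_snoc] at hA
  rcases hA with rfl | hA
  · exact hgT
  · exact mem_normalizer_iff.1 hg A hA

end Snoc

/-- If a morphism of `F` maps one chain to another of the same length, then the extensions of these
chains by corresponding subgroups are isomorphic. -/
theorem isomorphic_snoc {c d : F.NormalChain X} (hl : c.length = d.length) {P Q : Subgroup S}
    {ψ : P →* Q} (hψ : ψ ∈ F.hom P Q) (h : ∀ A ∈ c.terms, image ψ A ∈ d.terms)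
    {T U : Subgroup S} (hTP : T ≤ P) (hTU : image ψ T = U) (hT : T ∈ X) (hlt : c.top < T)
    (hn : T ≤ c.normalizer) (hU : U ∈ X) (hlt' : d.top < U) (hn' : U ≤ d.normalizer) :
    (c.snoc hT hlt hn).Isomorphic (d.snoc hU hlt' hn') := by
  refine Maps.isomorphic (maps_of_image_mem hψ ((c.top_snoc hT hlt hn).trans_le hTP)
    fun A hA => ?_) (congrArg (· + 1) hl)
  rw [terms_snoc] at hA ⊢
  rcases hA with rfl | hA
  · exact Or.inl hTU
  · exact Or.inr (h A hA)

/-- Every chain is isomorphic to a chain `d` whose normalizer receives the normalizer of every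
chain isomorphic to `d`, by a morphism of `F` compatible with the chains. -/
theorem exists_fullyNormalized [Finite S] {p : ℕ} [Fact p.Prime] (hS : IsPGroup p S)
    (hF : F.IsSaturated p) (hX : F.IsUpwardClosed X) (c : F.NormalChain X) :
    ∃ d : F.NormalChain X, c.Isomorphic d ∧ ∀ b : F.NormalChain X, b.Isomorphic d →
      ∃ ψ ∈ F.hom b.normalizer d.normalizer, ∀ A ∈ b.terms, image ψ A ∈ d.terms := by
  obtain ⟨Q, e, he, hQ⟩ := F.exists_isIso_fullyNormalized c.top
  obtain ⟨g, hg, hext⟩ := hF.exists_extend_family hS hQ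
    (A := fun i => image e.toMonoidHom (c.term i)) fun i => image_le _ _
  have heg : F.IsIso (e.trans g) := he.trans hg
  refine ⟨c.map hX heg.1 le_rfl, isomorphic_map hX c heg.1 le_rfl, fun b hb => ?_⟩
  obtain ⟨hl, f, hf, hfi⟩ := hb.trans (isomorphic_map hX c heg.1 le_rfl).symm
  have hi : ∀ i, image (f.trans (e.trans g)).toMonoidHom (b.term i) =
      image (e.trans g).toMonoidHom (c.term (Fin.cast (congrArg (· + 1) hl) i)) := fun i => by
    rw [← hfi i]
    exact image_comp f.toMonoidHom (e.trans g).toMonoidHom _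
  have hmul : ∀ j, image (e.trans g).toMonoidHom (c.term j) =
      image g.toMonoidHom (image e.toMonoidHom (c.term j)) := fun j =>
    image_comp e.toMonoidHom (MulEquiv.toMonoidHom g) (c.term j)
  obtain ⟨ψ, hψ, hψi⟩ := hext b.top b.normalizer (f.trans (e.trans g))
    (fun j => b.term (Fin.cast (congrArg (· + 1) hl.symm) j)) (hf.trans heg)
    (fun j => b.term_le_top _) b.top_le_normalizer (normalizer_le b.top_mem_terms)
    (fun j => normalizer_le ⟨_, rfl⟩) fun j => (hi _).trans (hmul j)
  have hmem : ∀ j, image ψ (b.term (Fin.cast (congrArg (· + 1) hl.symm) j)) =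
      (c.map hX heg.1 le_rfl).term j := fun j => (hψi j).trans (hmul j).symm
  have hle : image ψ b.normalizer ≤ (c.map hX heg.1 le_rfl).normalizer := by
    refine le_normalizer_iff.2 ?_
    rintro _ ⟨j, rfl⟩
    rw [← hmem j]
    rintro _ ⟨x, -, rfl⟩
    exact apply_mem_normalizer_image ψ (normalizer_le (Set.mem_range_self _) x.2)
  obtain ⟨ψ', hψ', hval⟩ := exists_restrict hψ le_rfl hle
  refine ⟨ψ', hψ', ?_⟩
  rintro _ ⟨i, rfl⟩
  rw [image_restrict hval ((b.term_le_top i).trans b.top_le_normalizer)]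
  exact ⟨_, (hmem (Fin.cast (congrArg (· + 1) hl) i)).symm⟩

end NormalChain

end FusionSystem

/-! ### The poset of isomorphism classes -/

namespace FusionSystem

namespace NormalChainClass

open NormalChain

variable {S : Type u} [Group S] {F : FusionSystem S} {X : Set (Subgroup S)}

/-- The isomorphism class of a chain. -/
def mk (c : F.NormalChain X) : F.NormalChainClass X := Quotient.mk _ c

theorem exists_mk_eq (x : F.NormalChainClass X) : ∃ c, mk c = x := Quotient.exists_rep x

theorem mk_le_mk {c d : F.NormalChain X} : mk c ≤ mk d ↔ c.Maps d := Iff.rfl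

theorem mk_eq_mk {c d : F.NormalChain X} : mk c = mk d ↔ c.Isomorphic d := Quotient.eq

theorem mk_le_mk_of_subset {c d : F.NormalChain X} (h : c.terms ⊆ d.terms) : mk c ≤ mk d :=
  maps_of_terms_subset h

/-- The length of the chains in an isomorphism class. -/
def length : F.NormalChainClass X → ℕ :=
  Quotient.lift NormalChain.length fun _ _ h => h.1

theorem length_lt {x y : F.NormalChainClass X} (h : x < y) : x.length < y.length := by
  obtain ⟨c, rfl⟩ := exists_mk_eq x
  obtain ⟨d, rfl⟩ := exists_mk_eq y
  refine lt_of_le_of_ne (Maps.length_le h.le) fun hl => h.ne ?_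
  exact mk_eq_mk.2 (Maps.isomorphic h.le hl)

/-- The classes below the class of `d` are represented by the subchains of `d`. -/
theorem exists_subset_of_le (hX : F.IsUpwardClosed X) {y : F.NormalChainClass X}
    {d : F.NormalChain X} (h : y ≤ mk d) : ∃ c, mk c = y ∧ c.terms ⊆ d.terms := by
  obtain ⟨c, rfl⟩ := exists_mk_eq y
  obtain ⟨φ, hφ, hi⟩ := Maps.exists_image (mk_le_mk.1 h)
  refine ⟨c.map hX hφ le_rfl, mk_eq_mk.2 (isomorphic_map hX c hφ le_rfl).symm, ?_⟩
  rintro _ ⟨i, rfl⟩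
  exact hi _ ⟨i, rfl⟩

/-- The largest order of the normalizer of a chain in the given class. -/
noncomputable def height (x : F.NormalChainClass X) : ℕ :=
  ⨆ d : {d : F.NormalChain X // mk d = x}, Nat.card d.1.normalizer

/-- The class contains a chain whose top has the order `x.height`, hence is the whole normalizer of
the chain. -/
def IsFull (x : F.NormalChainClass X) : Prop :=
  ∃ d : F.NormalChain X, mk d = x ∧ Nat.card d.top = x.height

theorem IsFull.card_top {c : F.NormalChain X} (h : (mk c).IsFull) :
    Nat.card c.top = (mk c).height := by
  obtain ⟨d, hd, hcard⟩ := h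
  rw [← hcard]
  exact (mk_eq_mk.1 hd).card_top.symm

open Classical in
/-- The key that determines the order in which the classes are added: by decreasing height, then
the full classes before the others, then by increasing length. -/
noncomputable def key (x : F.NormalChainClass X) : ℕᵒᵈ ×ₗ (ℕ ×ₗ ℕ) :=
  toLex (OrderDual.toDual x.height, toLex (if x.IsFull then 0 else 1, x.length))

theorem key_lt_key {x y : F.NormalChainClass X} :
    y.key < x.key ↔ x.height < y.height ∨ y.height = x.height ∧
      (y.IsFull ∧ ¬ x.IsFull ∨ (y.IsFull ↔ x.IsFull) ∧ y.length < x.length) := by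
  rw [key, key, Prod.Lex.toLex_lt_toLex, Prod.Lex.toLex_lt_toLex]
  refine or_congr Iff.rfl (and_congr (OrderDual.toDual_inj) ?_)
  by_cases hx : x.IsFull <;> by_cases hy : y.IsFull <;> simp [hx, hy]

theorem key_ne_key {x y : F.NormalChainClass X} (h : x < y) : x.key ≠ y.key := fun he =>
  (length_lt h).ne (congrArg (fun k => (ofLex (ofLex k).2).2) he)

variable [Finite S]

/-- Subchains of one chain are compared by inclusion. -/
theorem subset_of_mk_le_mk {c b d : F.NormalChain X} (hc : c.terms ⊆ d.terms)
    (hb : b.terms ⊆ d.terms) (h : mk c ≤ mk b) : c.terms ⊆ b.terms := by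
  obtain ⟨φ, hφ, hi⟩ := Maps.exists_image (mk_le_mk.1 h)
  intro A hA
  have := eq_of_card_eq (hc hA) (hb (hi A hA)) (card_image (F.injective hφ) (le_top hA)).symm
  rw [this]
  exact hi A hA

instance : Finite (F.NormalChainClass X) := by
  refine Finite.of_injective (fun x : F.NormalChainClass X => (Quotient.out x).terms)
    fun x y h => ?_
  rw [← Quotient.out_eq x, ← Quotient.out_eq y]
  exact le_antisymm (mk_le_mk_of_subset h.le) (mk_le_mk_of_subset h.ge)

theorem card_normalizer_le (d : F.NormalChain X) : Nat.card d.normalizer ≤ (mk d).height :=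
  le_ciSup (f := fun d : {c : F.NormalChain X // mk c = mk d} => Nat.card d.1.normalizer)
    ⟨Nat.card S, by rintro _ ⟨b, rfl⟩; exact Subgroup.card_le_card_group _⟩ ⟨d, rfl⟩

theorem card_top_le (d : F.NormalChain X) : Nat.card d.top ≤ (mk d).height :=
  (Subgroup.card_le_of_le d.top_le_normalizer).trans (card_normalizer_le d)

/-- A chain whose top attains the height of its class is normalized by its top only. -/
theorem top_eq_normalizer {d : F.NormalChain X} (h : Nat.card d.top = (mk d).height) :
    d.top = d.normalizer :=
  Subgroup.eq_of_le_of_card_ge d.top_le_normalizer (h ▸ card_normalizer_le d)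

/-- A representative of the class `x` with the properties of a fully normalized subgroup: its
normalizer has order `x.height`, and receives the normalizers of all representatives. -/
theorem exists_fullyNormalized {p : ℕ} [Fact p.Prime] (hS : IsPGroup p S)
    (hF : F.IsSaturated p) (hX : F.IsUpwardClosed X) (x : F.NormalChainClass X) :
    ∃ d : F.NormalChain X, mk d = x ∧ Nat.card d.normalizer = x.height ∧
      ∀ b : F.NormalChain X, mk b = x →
        ∃ ψ ∈ F.hom b.normalizer d.normalizer, ∀ A ∈ b.terms, image ψ A ∈ d.terms := by
  obtain ⟨c, rfl⟩ := exists_mk_eq x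
  obtain ⟨d, hcd, hd⟩ := NormalChain.exists_fullyNormalized hS hF hX c
  have hd' : ∀ b : F.NormalChain X, mk b = mk c →
      ∃ ψ ∈ F.hom b.normalizer d.normalizer, ∀ A ∈ b.terms, image ψ A ∈ d.terms :=
    fun b hb => hd b ((mk_eq_mk.1 hb).trans hcd)
  refine ⟨d, mk_eq_mk.2 hcd.symm, le_antisymm ?_ ?_, hd'⟩
  · rw [← mk_eq_mk.2 hcd.symm]
    exact card_normalizer_le d
  · have : Nonempty {d : F.NormalChain X // mk d = mk c} := ⟨⟨c, rfl⟩⟩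
    refine ciSup_le fun b => ?_
    obtain ⟨ψ, hψ, -⟩ := hd' b.1 b.2
    exact Nat.card_le_card_of_injective ψ (F.injective hψ)

theorem height_anti {p : ℕ} [Fact p.Prime] (hS : IsPGroup p S)
    (hF : F.IsSaturated p) (hX : F.IsUpwardClosed X) {x y : F.NormalChainClass X} (h : x ≤ y) :
    y.height ≤ x.height := by
  obtain ⟨d, rfl, hd, -⟩ := exists_fullyNormalized hS hF hX y
  obtain ⟨c, rfl, hc⟩ := exists_subset_of_le hX h
  rw [← hd]
  exact (Subgroup.card_le_of_le (normalizer_anti hc)).trans (card_normalizer_le c)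

/-! ### Acyclicity of the poset of classes -/

section Links

variable {p : ℕ} [Fact p.Prime] (hS : IsPGroup p S) (hF : F.IsSaturated p)
  (hX : F.IsUpwardClosed X)
include hS hF hX

/-- The classes that occur in the link of a full class lie below it. -/
theorem IsFull.lt_of_key_lt {x y : F.NormalChainClass X} (hx : x.IsFull) (hc : y ≤ x ∨ x ≤ y)
    (hk : y.key < x.key) : y < x := by
  refine lt_of_le_of_ne (hc.resolve_right fun hxy => ?_) fun he => hk.ne (congrArg key he)
  rcases key_lt_key.1 hk with h | ⟨-, h | h⟩
  · exact (height_anti hS hF hX hxy).not_gt h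
  · exact h.2 hx
  · exact (length_lt (lt_of_le_of_ne hxy fun he => hk.ne (congrArg key he.symm))).not_gt h.2

/-- If adding a largest term to a chain gives a full class whose height is the order of that term,
then the height does not change: otherwise the new term would be properly normalized in the
normalizer of a fully normalized representative. -/
theorem height_eq_of_snoc {c : F.NormalChain X} {T : Subgroup S} (hT : T ∈ X)
    (hlt : c.top < T) (hn : T ≤ c.normalizer)
    (hcard : Nat.card T = (mk (c.snoc hT hlt hn)).height) : (mk c).height = Nat.card T := by
  obtain ⟨d, hd, hdcard, hext⟩ := exists_fullyNormalized hS hF hX (mk c)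
  obtain ⟨ψ, hψ, hi⟩ := hext c rfl
  have hinj := F.injective hψ
  have hcd := mk_eq_mk.1 hd
  have htop : image ψ c.top = d.top := by
    refine Subgroup.eq_of_le_of_card_ge (le_top (hi _ c.top_mem_terms)) ?_
    rw [card_image hinj c.top_le_normalizer, hcd.card_top]
  have hlt' : d.top < image ψ T := htop ▸ image_strictMono hinj hn hlt
  have hU : image ψ T ∈ X := hX.image_mem hψ hn hT
  have hiso := isomorphic_snoc hcd.1.symm hψ hi hn rfl hT hlt hn hU hlt' (image_le ψ T)
  have hUT : Nat.card (image ψ T) = Nat.card T := card_image hinj hn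
  -- The normalizer of the extended chain is its top, hence `image ψ T` is self-normalizing.
  have hself := top_eq_normalizer (d := d.snoc hU hlt' (image_le ψ T)) <| by
    rw [top_snoc, hUT, hcard, mk_eq_mk.2 hiso]
  rw [top_snoc] at hself
  have hU' : image ψ T = d.normalizer :=
    eq_of_forall_mem_normalizer hS (image_le ψ T) fun g hg hgU =>
      hself ▸ mem_normalizer_snoc d hU hlt' (image_le ψ T) hg hgU
  rw [← hdcard, ← hU', hUT]

/-- The link of a full class other than that of `S` is contracted to the class of the top `T` of a
representative by adding `T` to the subchains. -/
theorem acyclic_link_of_isFull (hST : ⊤ ∈ X) {x : F.NormalChainClass X} (hx : x.IsFull)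
    (hxS : x ≠ mk (single F hST)) :
    PosetCochain.Acyclic {y : F.NormalChainClass X | (y ≤ x ∨ x ≤ y) ∧ y.key < x.key} := by
  obtain ⟨d, rfl⟩ := exists_mk_eq x
  have hcard := hx.card_top
  have hT : d.top ∈ X := d.mem _
  have hsub : (single F hT).terms ⊆ d.terms := fun A hA => by
    rw [(mem_terms_single hT).1 hA]
    exact d.top_mem_terms
  have hlast : ∀ z, z ≤ mk d → z ≠ mk d → (z.height = (mk d).height → z.IsFull) →
      z.key < (mk d).key := fun z hz hne h => by
    refine key_lt_key.2 ?_
    rcases (height_anti hS hF hX hz).lt_or_eq with h' | h'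
    · exact Or.inl h'
    · exact Or.inr ⟨h'.symm, Or.inr ⟨iff_of_true (h h'.symm) hx,
        length_lt (lt_of_le_of_ne hz hne)⟩⟩
  have htop : (single F hT).top = d.top := rfl
  have ht : mk (single F hT) ∈ {y | (y ≤ mk d ∨ mk d ≤ y) ∧ y.key < (mk d).key} := by
    have hle := mk_le_mk_of_subset hsub
    refine ⟨Or.inl hle, hlast _ hle (fun he => ?_) fun h => ⟨_, rfl, by rw [htop, hcard, h]⟩⟩
    have hself := top_eq_normalizer (d := single F hT) (by rw [htop, hcard, he])
    have hdS : d.top = ⊤ := eq_of_forall_mem_normalizer hS le_top fun g _ hg => by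
      rw [← htop, hself]
      refine mem_normalizer_iff.2 fun A hA => ?_
      rwa [(mem_terms_single hT).1 hA]
    refine hxS (he.symm.trans (le_antisymm ?_ ?_))
    all_goals
      refine mk_le_mk_of_subset fun A hA => ?_
      rw [mem_terms_single] at hA ⊢
      simp [hA, hdS]
  refine PosetCochain.acyclic_of_forall_isLeast ht fun y hy => ?_
  have hyd := hx.lt_of_key_lt hS hF hX hy.1 hy.2
  obtain ⟨c, rfl, hc⟩ := exists_subset_of_le hX hyd.le
  by_cases hmem : d.top ∈ c.terms
  · refine ⟨mk c, ⟨hy, le_rfl, mk_le_mk_of_subset fun A hA => ?_⟩, fun w hw => hw.2.1⟩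
    rwa [(mem_terms_single hT).1 hA]
  have hlt : c.top < d.top := lt_of_le_of_ne (NormalChain.le_top (hc c.top_mem_terms))
    fun he => hmem (he ▸ c.top_mem_terms)
  have hn : d.top ≤ c.normalizer := d.top_le_normalizer.trans (normalizer_anti hc)
  have hterms := c.terms_snoc hT hlt hn
  have hzd : mk (c.snoc hT hlt hn) ≤ mk d := mk_le_mk_of_subset <| by
    rw [hterms]
    exact Set.insert_subset d.top_mem_terms hc
  have hne : mk (c.snoc hT hlt hn) ≠ mk d := fun he => by
    -- Otherwise `c` has the height of `d` without being full.
    have hh := height_eq_of_snoc hS hF hX hT hlt hn (by rw [hcard, he])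
    have hfull : ¬ (mk c).IsFull := fun hf =>
      hlt.ne (Subgroup.eq_of_le_of_card_ge hlt.le (hf.card_top.trans hh).ge)
    rcases key_lt_key.1 hy.2 with h | ⟨-, h | h⟩
    · rw [hh, hcard] at h
      exact h.false
    · exact hfull h.1
    · exact hfull (h.1.2 hx)
  refine ⟨mk (c.snoc hT hlt hn), ⟨⟨Or.inl hzd, hlast _ hzd hne fun h =>
    ⟨_, rfl, by rw [top_snoc, hcard, h]⟩⟩, c.maps_snoc hT hlt hn,
      mk_le_mk_of_subset fun A hA => ?_⟩, fun w hw => ?_⟩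
  · rw [hterms, (mem_terms_single hT).1 hA]
    exact Or.inl rfl
  · have hwd := (hx.lt_of_key_lt hS hF hX hw.1.1 hw.1.2).le
    obtain ⟨b, rfl, hb⟩ := exists_subset_of_le hX hwd
    refine mk_le_mk_of_subset ?_
    rw [hterms]
    exact Set.insert_subset
      (subset_of_mk_le_mk hsub hb hw.2.2 ((mem_terms_single hT).2 rfl))
      (subset_of_mk_le_mk hc hb hw.2.1)

/-- The link of a class `x` that is not full is contracted to the class obtained by adding its
normalizer to a fully normalized representative of `x`: this is the least full class of the
same height above `x`. -/
theorem acyclic_link_of_not_isFull {x : F.NormalChainClass X} (hx : ¬ x.IsFull) :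
    PosetCochain.Acyclic {y : F.NormalChainClass X | (y ≤ x ∨ x ≤ y) ∧ y.key < x.key} := by
  obtain ⟨d, rfl, hcard, hext⟩ := exists_fullyNormalized hS hF hX x
  have hlt : d.top < d.normalizer := lt_of_le_of_ne d.top_le_normalizer fun he =>
    hx ⟨d, rfl, by rw [he, hcard]⟩
  have hN : d.normalizer ∈ X := hX _ (F.inclusion_mem d.top_le_normalizer) (d.mem _)
  have hle : mk d ≤ mk (d.snoc hN hlt le_rfl) := d.maps_snoc hN hlt le_rfl
  have hheight : (mk (d.snoc hN hlt le_rfl)).height = (mk d).height := by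
    refine le_antisymm (height_anti hS hF hX hle) ?_
    have h := card_top_le (d.snoc hN hlt le_rfl)
    rwa [top_snoc, hcard] at h
  have hfull : (mk (d.snoc hN hlt le_rfl)).IsFull := ⟨_, rfl, by rw [top_snoc, hcard, hheight]⟩
  refine PosetCochain.acyclic_of_forall_comparable (x := mk (d.snoc hN hlt le_rfl))
    ⟨Or.inr hle, key_lt_key.2 (Or.inr ⟨hheight, Or.inl ⟨hfull, hx⟩⟩)⟩ ?_
  rintro y ⟨hyx | hxy, hk⟩
  · exact Or.inl (hyx.trans hle)
  right
  obtain ⟨hh, hy⟩ : y.height = (mk d).height ∧ y.IsFull := by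
    rcases key_lt_key.1 hk with h | ⟨h, h' | h'⟩
    · exact absurd h (height_anti hS hF hX hxy).not_gt
    · exact ⟨h, h'.1⟩
    · exact absurd h'.2
        (length_lt (lt_of_le_of_ne hxy fun he => hk.ne (congrArg key he.symm))).not_gt
  obtain ⟨b, rfl⟩ := exists_mk_eq y
  obtain ⟨c, hcd, hcb⟩ := exists_subset_of_le hX hxy
  have hbtop := hy.card_top
  -- The top of `b` is the normalizer of its subchain `c`.
  have hcN : b.top = c.normalizer := by
    rw [top_eq_normalizer hbtop]
    refine Subgroup.eq_of_le_of_card_ge (normalizer_anti hcb) ?_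
    rw [← top_eq_normalizer hbtop, hbtop, hh, ← hcd]
    exact card_normalizer_le c
  have hcard' : Nat.card c.normalizer = Nat.card d.normalizer := by
    rw [← hcN, hbtop, hh, hcard]
  have hlt' : c.top < c.normalizer := lt_of_le_of_ne c.top_le_normalizer fun he =>
    hx ⟨c, hcd, by rw [he, hcard', hcard]⟩
  have hN' : c.normalizer ∈ X := hX _ (F.inclusion_mem c.top_le_normalizer) (c.mem _)
  obtain ⟨ψ, hψ, hi⟩ := hext c hcd
  have himage : image ψ c.normalizer = d.normalizer :=
    Subgroup.eq_of_le_of_card_ge (image_le _ _) (by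
      rw [card_image (F.injective hψ) le_rfl, hcard'])
  have hiso := isomorphic_snoc (mk_eq_mk.1 hcd).1 hψ hi le_rfl himage hN' hlt' le_rfl hN hlt
    le_rfl
  rw [← mk_eq_mk.2 hiso]
  refine mk_le_mk_of_subset ?_
  rw [terms_snoc, ← hcN]
  exact Set.insert_subset b.top_mem_terms hcb

/-- The poset of isomorphism classes is built up from the class of `S`. -/
theorem acyclic_univ (hST : ⊤ ∈ X) :
    PosetCochain.Acyclic (Set.univ : Set (F.NormalChainClass X)) := by
  have hle : ∀ x : F.NormalChainClass X, x.height ≤ Nat.card S := fun x => by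
    obtain ⟨d, -, hd, -⟩ := exists_fullyNormalized hS hF hX x
    rw [← hd]
    exact Subgroup.card_le_card_group _
  have htop : Nat.card (single F hST).top = Nat.card S := Subgroup.card_top
  have hheight : (mk (single F hST)).height = Nat.card S :=
    le_antisymm (hle _) (htop.symm.le.trans (card_top_le _))
  have hfull : (mk (single F hST)).IsFull := ⟨_, rfl, htop.trans hheight.symm⟩
  refine PosetCochain.acyclic_univ_of_links key (mk (single F hST)) (fun x => ?_)
    (fun x y => key_ne_key) fun x hx => ?_
  · refine not_lt.1 fun hk => ?_
    rcases key_lt_key.1 hk with h | ⟨-, h | h⟩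
    · exact absurd (hle x) (not_le.2 (hheight ▸ h))
    · exact h.2 hfull
    · exact absurd h.2 (Nat.not_lt_zero _)
  · by_cases hf : x.IsFull
    · exact acyclic_link_of_isFull hS hF hX hST hf hx
    · exact acyclic_link_of_not_isFull hS hF hX hf

end Links

end NormalChainClass

theorem isUpwardClosed_univ {S : Type u} [Group S] (F : FusionSystem S) :
    F.IsUpwardClosed Set.univ :=
  fun _ _ _ _ _ => Set.mem_univ _

theorem isUpwardClosed_ne_bot {S : Type u} [Group S] (F : FusionSystem S) :
    F.IsUpwardClosed {Q | Q ≠ ⊥} := by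
  rintro P Q φ hφ hP rfl
  exact hP ((Subgroup.eq_bot_iff_forall P).2 fun x hx => congrArg Subtype.val
    (F.injective hφ (Subsingleton.elim (φ ⟨x, hx⟩) (φ 1))))

end FusionSystem

theorem mainTheorem3 {S : Type u} [Group S] [Finite S] (p : ℕ) [Fact p.Prime]
    (hS : IsPGroup p S) (F : FusionSystem S) (hF : F.IsSaturated p) :
    ((∀ n : ℕ, 1 ≤ n →
        Subsingleton (integerCohomology (F.NormalChainClass Set.univ)ᵒᵈ n)) ∧
      Nonempty (integerCohomology (F.NormalChainClass Set.univ)ᵒᵈ 0 ≃ₗ[ℤ] ℤ)) ∧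
    (Nontrivial S →
      (∀ n : ℕ, 1 ≤ n →
        Subsingleton (integerCohomology (F.NormalChainClass {Q | Q ≠ ⊥})ᵒᵈ n)) ∧
      Nonempty (integerCohomology (F.NormalChainClass {Q | Q ≠ ⊥})ᵒᵈ 0 ≃ₗ[ℤ] ℤ)) := by
  have h1 := FusionSystem.NormalChainClass.acyclic_univ hS hF F.isUpwardClosed_univ
    (Set.mem_univ _)
  refine ⟨⟨fun n hn => h1.subsingleton_integerCohomology hn,
    h1.nonempty_integerCohomology_zero⟩, fun _ => ?_⟩
  have h2 := FusionSystem.NormalChainClass.acyclic_univ hS hF F.isUpwardClosed_ne_bot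
    (show (⊤ : Subgroup S) ∈ {Q : Subgroup S | Q ≠ ⊥} from top_ne_bot)
  exact ⟨fun n hn => h2.subsingleton_integerCohomology hn, h2.nonempty_integerCohomology_zero⟩
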